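/- A metric-measure space $X=(X,d,\mu)$ is a compact metric space $(X,d)$ with a finite Borel measure $\mu$; $B_r(x)=\{y: d(x,y)<r\}$ and $\operatorname{supp}(\mu)$ is the set of points all of whose neighbourhoods have positive measure. For $\rho>0$ the $\rho$-Laplacian is the bounded operator on $L^2(X,\mu)$ $$\Delta^\rho_X u(x)=\frac1{\rho^2\mu(B_\rho(x))}\int_{B_\rho(x)}\bigl(u(x)-u(y)\bigr)\,d\mu(y).$$ The essential spectrum of $\Delta^\rho_X$ is the part of the spectrum that does not consist of isolated eigenvalues of finite multiplicity, and $\lambda_\infty$ is its infimum ($\lambda_\infty=\infty$ if it is empty). For $R>0$ let $\#^\rho_X(R)$ be the number of eigenvalues of $\Delta^\rho_X$ in $[0,R]$, counted with multiplicities, with $\#^\rho_X(R)=\infty$ if $R\ge\lambda_\infty$. Let $N_X(r)$ be the maximum number of points in a subset of $X$ any two distinct points of which are at distance at least $r$. For $\Lambda>0$ and $0<\varepsilon\le r/2$, the space $X$ satisfies $BIV(\Lambda,r,\varepsilon)$ if for all $x,y\in\operatorname{supp}(\mu)$ with $d(x,y)\le r+\varepsilon$, $$\mu(B_r(x)\cap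 B_r(y))\ge\Lambda^{-1}\mu(B_{r+\varepsilon}(x)).$$ **Theorem 7.1.** For every $\Lambda\ge1$ there exists $c=c(\Lambda)>0$ such that the following holds. Let $\rho>0$ and let $X$ be a metric-measure space that satisfies $BIV(\Lambda,\tfrac56\rho,\tfrac5{12}\rho)$ and the restricted doubling condition $$\mu(B_{5\rho/3}(x))\le\Lambda\,\mu(B_{5\rho/6}(x))\qquad\text{for all }x\in\operatorname{supp}(\mu).$$ Then $$\#^\rho_X(c\rho^{-2})\le N_X(\rho/24).$$ -/

import Mathlib

open MeasureTheory Metric Set Filter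
open scoped ENNReal Topology

noncomputable section

namespace MMLaplacian

lemma integrable_Lp {Y : Type*} [MeasurableSpace Y] (μ : Measure Y) [IsFiniteMeasure μ]
    (u : Lp ℝ 2 μ) : Integrable u μ :=
  memLp_one_iff_integrable.1 ((Lp.memLp u).mono_exponent (by norm_num))

variable {X : Type*} [MetricSpace X] [MeasurableSpace X]

/-- The `ρ`-Laplacian applied to a function `u`, pointwise:
`(ρ² μ(B_ρ(x)))⁻¹ ∫_{B_ρ(x)} (u(x) - u(y)) dμ(y)`, where `B_ρ(x)` is the open ball. -/
def rhoLapFun (μ : Measure X) (ρ : ℝ) (u : X → ℝ) (x : X) : ℝ :=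
  (ρ ^ 2 * μ.real (ball x ρ))⁻¹ * ∫ y in ball x ρ, (u x - u y) ∂μ

section Construction

variable (μ : Measure X) (ρ : ℝ)

lemma rhoLapFun_smul (a : ℝ) (u : Lp ℝ 2 μ) :
    rhoLapFun μ ρ ↑(a • u) =ᵐ[μ] a • rhoLapFun μ ρ u := by
  filter_upwards [Lp.coeFn_smul a u] with x hx
  simp only [Pi.smul_apply, rhoLapFun, smul_eq_mul]
  have h : ∫ y in ball x ρ, ((a • u : Lp ℝ 2 μ) x - (a • u : Lp ℝ 2 μ) y) ∂μ =
      ∫ y in ball x ρ, a * (u x - u y) ∂μ := by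
    refine integral_congr_ae ?_
    filter_upwards [ae_restrict_of_ae (Lp.coeFn_smul a u)] with y hy
    rw [hx, hy]
    simp only [Pi.smul_apply, smul_eq_mul]
    ring
  rw [h, integral_const_mul, mul_left_comm]

variable [IsFiniteMeasure μ]

lemma rhoLapFun_add (u v : Lp ℝ 2 μ) :
    rhoLapFun μ ρ ↑(u + v) =ᵐ[μ] rhoLapFun μ ρ u + rhoLapFun μ ρ v := by
  filter_upwards [Lp.coeFn_add u v] with x hx
  simp only [Pi.add_apply, rhoLapFun]
  rw [← mul_add, ← integral_add]
  · congr 1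
    refine integral_congr_ae ?_
    filter_upwards [ae_restrict_of_ae (Lp.coeFn_add u v)] with y hy
    rw [hx, hy]
    simp only [Pi.add_apply]
    ring
  · exact ((integrable_const _).sub (integrable_Lp μ u)).integrableOn
  · exact ((integrable_const _).sub (integrable_Lp μ v)).integrableOn

variable [CompactSpace X] [BorelSpace X]

/-- On a compact space the measures of the balls of a given radius are bounded away from zero,
up to a null set of centres. -/
lemma exists_inv_le : ∃ C : ℝ, 0 ≤ C ∧ ∀ᵐ x ∂μ, (ρ ^ 2 * μ.real (ball x ρ))⁻¹ ≤ C := by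
  rcases le_or_gt ρ 0 with h | h
  · refine ⟨0, le_rfl, Eventually.of_forall fun x => ?_⟩
    rw [ball_eq_empty.2 h]; simp
  · obtain ⟨t, -, htf, ht⟩ := (isCompact_univ (X := X)).finite_cover_balls (half_pos h)
    have key : ∀ z : X, ∃ C : ℝ, 0 ≤ C ∧
        ∀ᵐ x ∂μ, x ∈ ball z (ρ / 2) → (ρ ^ 2 * μ.real (ball x ρ))⁻¹ ≤ C := by
      intro z
      rcases eq_or_ne (μ (ball z (ρ / 2))) 0 with hz | hz
      · refine ⟨0, le_rfl, ?_⟩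
        have : ∀ᵐ x ∂μ, x ∉ ball z (ρ / 2) := measure_eq_zero_iff_ae_notMem.1 hz
        filter_upwards [this] with x hx hx' using absurd hx' hx
      · have hpos : 0 < μ.real (ball z (ρ / 2)) :=
          ENNReal.toReal_pos hz (measure_ne_top _ _)
        refine ⟨(ρ ^ 2 * μ.real (ball z (ρ / 2)))⁻¹, by positivity,
          Eventually.of_forall fun x hx => ?_⟩
        have hsub : ball z (ρ / 2) ⊆ ball x ρ := by
          intro y hy
          rw [mem_ball] at *
          have := dist_triangle_right y x z
          linarith
        have : μ.real (ball z (ρ / 2)) ≤ μ.real (ball x ρ) := measureReal_mono hsub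
        gcongr
    choose C hC0 hC using key
    refine ⟨∑ z ∈ htf.toFinset, C z, Finset.sum_nonneg fun z _ => hC0 z, ?_⟩
    have hall : ∀ᵐ x ∂μ, ∀ z ∈ t, x ∈ ball z (ρ / 2) → (ρ ^ 2 * μ.real (ball x ρ))⁻¹ ≤ C z :=
      (ae_ball_iff htf.countable).2 fun z _ => hC z
    filter_upwards [hall] with x hx
    obtain ⟨z, hz, hxz⟩ := mem_iUnion₂.1 (ht (mem_univ x))
    exact (hx z hz hxz).trans
      (Finset.single_le_sum (f := C) (fun z _ => hC0 z) (htf.mem_toFinset.2 hz))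

lemma rhoLapFun_stronglyMeasurable {u : X → ℝ} (hu : StronglyMeasurable u) :
    StronglyMeasurable (rhoLapFun μ ρ u) := by
  have hS : MeasurableSet {p : X × X | dist p.2 p.1 < ρ} :=
    (isOpen_lt (continuous_snd.dist continuous_fst) continuous_const).measurableSet
  have h1 : StronglyMeasurable fun x => μ.real (ball x ρ) :=
    (measurable_measure_prodMk_left hS).ennreal_toReal.stronglyMeasurable
  have h2 : StronglyMeasurable fun x => ∫ y in ball x ρ, (u x - u y) ∂μ := by
    have : (fun x => ∫ y in ball x ρ, (u x - u y) ∂μ) = fun x =>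
        ∫ y, {p : X × X | dist p.2 p.1 < ρ}.indicator (fun p => u p.1 - u p.2) (x, y) ∂μ := by
      funext x
      rw [← integral_indicator measurableSet_ball]
      rfl
    rw [this]
    exact (((hu.comp_measurable measurable_fst).sub
      (hu.comp_measurable measurable_snd)).indicator hS).integral_prod_right'
  exact ((stronglyMeasurable_const.mul h1).measurable.inv.stronglyMeasurable).mul h2

/-- The `ρ`-Laplacian of `u ∈ L²` is dominated a.e. by an `L²` function, with a linear bound. -/
lemma exists_dominating : ∃ K : ℝ, ∀ u : Lp ℝ 2 μ, ∃ v : Lp ℝ 2 μ,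
    (∀ᵐ x ∂μ, ‖rhoLapFun μ ρ u x‖ ≤ ‖v x‖) ∧ ‖v‖ ≤ K * ‖u‖ := by
  obtain ⟨C, hC0, hC⟩ := exists_inv_le μ ρ
  let one : Lp ℝ 2 μ := Lp.const 2 μ 1
  refine ⟨C * (μ.real univ + ‖one‖ * ‖one‖), fun u => ?_⟩
  have hone : ∀ᵐ x ∂μ, one x = 1 := Lp.coeFn_const 2 μ (1 : ℝ)
  have hI : ∫ y, |u y| ∂μ ≤ ‖one‖ * ‖u‖ := by
    have h1 : inner ℝ one |u| = ∫ y, |u y| ∂μ := by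
      rw [L2.inner_def]
      refine integral_congr_ae ?_
      filter_upwards [hone, Lp.coeFn_abs u] with x h1 h2
      simp [h1, h2]
    rw [← h1, ← norm_abs_eq_norm u]
    exact real_inner_le_norm _ _
  have hI0 : 0 ≤ ∫ y, |u y| ∂μ := integral_nonneg fun y => abs_nonneg _
  refine ⟨C • (μ.real univ • |u| + (∫ y, |u y| ∂μ) • one), ?_, ?_⟩
  · filter_upwards [hC, hone, Lp.coeFn_abs u,
      Lp.coeFn_smul C (μ.real univ • |u| + (∫ y, |u y| ∂μ) • one),
      Lp.coeFn_add (μ.real univ • |u|) ((∫ y, |u y| ∂μ) • one),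
      Lp.coeFn_smul (μ.real univ) |u|, Lp.coeFn_smul (∫ y, |u y| ∂μ) one]
      with x hx h1 h2 h3 h4 h5 h6
    have hv : (C • (μ.real univ • |u| + (∫ y, |u y| ∂μ) • one) : Lp ℝ 2 μ) x
        = C * (μ.real univ * |u x| + ∫ y, |u y| ∂μ) := by
      rw [h3, Pi.smul_apply, h4, Pi.add_apply, h5, h6, Pi.smul_apply, Pi.smul_apply, h1, h2]
      simp
    have hint : Integrable (fun y => |u x| + |u y|) μ :=
      (integrable_const _).add (integrable_Lp μ u).abs
    have hb : |∫ y in ball x ρ, (u x - u y) ∂μ| ≤ μ.real univ * |u x| + ∫ y, |u y| ∂μ := by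
      calc |∫ y in ball x ρ, (u x - u y) ∂μ|
          ≤ ∫ y in ball x ρ, |u x - u y| ∂μ := abs_integral_le_integral_abs
        _ ≤ ∫ y in ball x ρ, (|u x| + |u y|) ∂μ := by
            refine integral_mono ?_ hint.integrableOn fun y => abs_sub _ _
            exact (((integrable_const _).sub (integrable_Lp μ u)).integrableOn).abs
        _ ≤ ∫ y, (|u x| + |u y|) ∂μ :=
            setIntegral_le_integral hint (Eventually.of_forall fun y => by positivity)
        _ = μ.real univ * |u x| + ∫ y, |u y| ∂μ := by
            rw [integral_add (integrable_const _) (integrable_Lp μ u).abs]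
            simp
    have hinv : 0 ≤ (ρ ^ 2 * μ.real (ball x ρ))⁻¹ := by positivity
    rw [hv, rhoLapFun, Real.norm_eq_abs, Real.norm_eq_abs, abs_mul, abs_of_nonneg hinv]
    exact (mul_le_mul hx hb (abs_nonneg _) hC0).trans (le_abs_self _)
  · have hM : (0 : ℝ) ≤ μ.real univ := by positivity
    calc ‖C • (μ.real univ • |u| + (∫ y, |u y| ∂μ) • one)‖
        ≤ C * (μ.real univ * ‖u‖ + (∫ y, |u y| ∂μ) * ‖one‖) := by
          rw [norm_smul, Real.norm_of_nonneg hC0]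
          gcongr
          refine (norm_add_le _ _).trans ?_
          rw [norm_smul, norm_smul, Real.norm_of_nonneg hM, Real.norm_of_nonneg hI0,
            norm_abs_eq_norm]
      _ ≤ C * (μ.real univ * ‖u‖ + (‖one‖ * ‖u‖) * ‖one‖) := by gcongr
      _ = _ := by ring

lemma rhoLapFun_memLp (u : Lp ℝ 2 μ) : MemLp (rhoLapFun μ ρ u) 2 μ := by
  obtain ⟨K, hK⟩ := exists_dominating μ ρ
  obtain ⟨v, hv, -⟩ := hK u
  exact (Lp.memLp v).of_le
    (rhoLapFun_stronglyMeasurable μ ρ (Lp.stronglyMeasurable u)).aestronglyMeasurable hv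

/-- The `ρ`-Laplacian as a linear map of `L²(X, μ)`. -/
def rhoLaplacianₗ : Lp ℝ 2 μ →ₗ[ℝ] Lp ℝ 2 μ where
  toFun u := (rhoLapFun_memLp μ ρ u).toLp
  map_add' u v := by
    exact (MemLp.toLp_congr _ ((rhoLapFun_memLp μ ρ u).add (rhoLapFun_memLp μ ρ v))
      (rhoLapFun_add μ ρ u v)).trans
      (MemLp.toLp_add (rhoLapFun_memLp μ ρ u) (rhoLapFun_memLp μ ρ v))
  map_smul' a u := by
    exact (MemLp.toLp_congr _ ((rhoLapFun_memLp μ ρ u).const_smul a)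
      (rhoLapFun_smul μ ρ a u)).trans (MemLp.toLp_const_smul a (rhoLapFun_memLp μ ρ u))

lemma rhoLaplacian_bound : ∃ K : ℝ, ∀ u, ‖rhoLaplacianₗ μ ρ u‖ ≤ K * ‖u‖ := by
  obtain ⟨K, hK⟩ := exists_dominating μ ρ
  refine ⟨K, fun u => ?_⟩
  obtain ⟨v, hv, hvK⟩ := hK u
  refine (Lp.norm_le_norm_of_ae_le ?_).trans hvK
  filter_upwards [hv, (rhoLapFun_memLp μ ρ u).coeFn_toLp] with x h1 h2
  exact (congrArg norm h2).le.trans h1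

/-- The `ρ`-Laplacian `Δ^ρ_X` as a bounded operator on the real Hilbert space `L²(X, μ)`. -/
def rhoLaplacian : Lp ℝ 2 μ →L[ℝ] Lp ℝ 2 μ :=
  (rhoLaplacianₗ μ ρ).mkContinuousOfExistsBound (rhoLaplacian_bound μ ρ)

lemma rhoLaplacian_coeFn (u : Lp ℝ 2 μ) : rhoLaplacian μ ρ u =ᵐ[μ] rhoLapFun μ ρ u :=
  (rhoLapFun_memLp μ ρ u).coeFn_toLp

end Construction

section Spectrum

variable {H : Type*} [NormedAddCommGroup H] [NormedSpace ℝ H]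

/-- The eigenspace of `T` for the value `t` (the zero subspace if `t` is not an eigenvalue). -/
def eigenspace (T : H →L[ℝ] H) (t : ℝ) : Submodule ℝ H :=
  Module.End.eigenspace (T : H →ₗ[ℝ] H) t

/-- The multiplicity of `t` as an eigenvalue of `T`: the dimension of the eigenspace in `ℕ∞`
(`0` if `t` is not an eigenvalue). -/
def eigenMultiplicity (T : H →L[ℝ] H) (t : ℝ) : ℕ∞ :=
  Cardinal.toENat (Module.rank ℝ (eigenspace T t))

/-- The discrete spectrum: the isolated points of the spectrum that are eigenvalues of finite
multiplicity. -/
def discreteSpectrum (T : H →L[ℝ] H) : Set ℝ :=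
  {t | t ∈ spectrum ℝ T ∧ (∃ ε > 0, ∀ s ∈ spectrum ℝ T, |s - t| < ε → s = t) ∧
    eigenMultiplicity T t ≠ 0 ∧ eigenMultiplicity T t ≠ ⊤}

/-- The essential spectrum: everything in the spectrum outside the discrete spectrum. -/
def essentialSpectrum (T : H →L[ℝ] H) : Set ℝ :=
  spectrum ℝ T \ discreteSpectrum T

/-- `λ_∞`: the infimum of the essential spectrum, equal to `⊤` if the essential spectrum is empty. -/
def lambdaInfty (T : H →L[ℝ] H) : EReal :=
  ⨅ t ∈ essentialSpectrum T, (t : EReal)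

open Classical in
/-- The number of eigenvalues of `T` in `[0, R]` counted with multiplicities, with the convention
that it is infinite if `R` is at least the infimum `λ_∞` of the essential spectrum.
With `λ_k` denoting the `k`-th smallest eigenvalue below `λ_∞`, and `λ_k = λ_∞` once these
are exhausted, this is `sup {k | λ_k ≤ R}` for a nonnegative self-adjoint `T`. -/
def eigenvalueCount (T : H →L[ℝ] H) (R : ℝ) : ℕ∞ :=
  if lambdaInfty T ≤ (R : EReal) then ⊤
  else ⨆ F : {F : Finset ℝ // (F : Set ℝ) ⊆ Icc 0 R}, ∑ t ∈ F.1, eigenMultiplicity T t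

end Spectrum

/-- The packing number `N_X(r)`: the largest cardinality of a subset of `X` any two distinct points
of which are at distance at least `r`. -/
def packNumber (X : Type*) [MetricSpace X] (r : ℝ) : ℕ∞ :=
  ⨆ S : {S : Set X // S.Pairwise fun x y => r ≤ dist x y}, S.1.encard

/-- The ball intersection volume condition with parameters `Λ`, `ρ`, `ε`
(used for `Λ > 0` and `0 < ε ≤ ρ / 2`). -/
def BIV (μ : Measure X) (Λ ρ ε : ℝ) : Prop :=
  ∀ x ∈ μ.support, ∀ y ∈ μ.support, dist x y ≤ ρ + ε →
    Λ⁻¹ * μ.real (ball x (ρ + ε)) ≤ μ.real (ball x ρ ∩ ball y ρ)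

end MMLaplacian

end

/-! The operator $T=\Delta^\rho_X$ is symmetric for the inner product weighted by
$w(x)=\mu(B_\rho(x))$ (`ballWeight`), with Dirichlet form
$\frac1{2\rho^2}\iint_{d(x,y)<\rho}(u(x)-u(y))^2$ (`integral_setIntegral_ball_sq_sub`). Take a
maximal $\rho/24$-separated set $S\subseteq\operatorname{supp}\mu$. It has at most $N_X(\rho/24)$
points, and each $y$ in the support is $\rho/24$-close to some $x\in S$, so $B_{5\rho/6}(x)\subseteq
B_\rho(y)\subseteq B_{5\rho/4}(x)$. By BIV with both centres at $x$, the outer volume is at most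
$\Lambda$ times the inner one. If $u$ has mean zero on every $B_{5\rho/6}(x)$, $x\in S$, then
$w(y)u(y)^2\le2\Lambda\int_{B_\rho(y)}(u(y)-u(z))^2\,d\mu(z)$. Integrating in $y$ bounds the form
below by $a=(4\Lambda\rho^2)^{-1}$ on a subspace cut out by $|S|$ linear conditions
(`spectralGap_of_net`). Min-max (`eigenvalueCount_le`) then gives at most $|S|$ eigenvalues below
$a$ and no essential spectrum there. -/

namespace MMLaplacian

/-! ### Min-max for an operator symmetric in a weighted inner product. -/

section Abstract

variable {H : Type*} [NormedAddCommGroup H]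

/-- An injective perturbation of a bijective linear map by a map of finite rank is surjective. -/
lemma surjective_sub_of_finiteDimensional_range {V : Type*} [AddCommGroup V] [Module ℝ V]
    {A F : V →ₗ[ℝ] V} (hA : Function.Bijective A) [FiniteDimensional ℝ F.range]
    (hinj : Function.Injective (A - F)) : Function.Surjective (A - F) := by
  let e := LinearEquiv.ofBijective A hA
  have he : ∀ v, A (e.symm v) = v := fun v => e.apply_symm_apply v
  have hmem : ∀ x : F.range, (x : V) - F (e.symm x) ∈ F.range := fun x =>
    F.range.sub_mem x.2 (LinearMap.mem_range_self _ _)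
  -- `G` is $1-FA^{-1}$ restricted to the finite-dimensional range of $F$, where injective implies
  -- surjective. If $Gv=FA^{-1}y$, then $A^{-1}(y+v)$ is a preimage of $y$ under $A-F$.
  let G : F.range →ₗ[ℝ] F.range :=
    { toFun := fun x => ⟨x - F (e.symm x), hmem x⟩
      map_add' := fun x y => by ext; simp; abel
      map_smul' := fun a x => by ext; simp [smul_sub] }
  have hG : Function.Injective G := by
    rw [injective_iff_map_eq_zero]
    intro x hx
    have hx' : (x : V) - F (e.symm x) = 0 := congrArg Subtype.val hx
    have : (A - F) (e.symm x) = (A - F) 0 := by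
      rw [LinearMap.sub_apply, he, hx', map_zero]
    have h0 := hinj this
    ext
    simpa using h0
  intro y
  obtain ⟨v, hv⟩ := (LinearMap.injective_iff_surjective.1 hG)
    ⟨F (e.symm y), LinearMap.mem_range_self _ _⟩
  have hv' : (v : V) - F (e.symm v) = F (e.symm y) := congrArg Subtype.val hv
  refine ⟨e.symm (y + v), ?_⟩
  rw [LinearMap.sub_apply, he, map_add, map_add, ← hv']
  abel

variable [InnerProductSpace ℝ H]

/-- The Lax-Milgram theorem for an operator with a coercive quadratic form. -/
lemma bijective_of_coercive [CompleteSpace H] {A : H →L[ℝ] H} {δ : ℝ} (hδ : 0 < δ)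
    (h : ∀ u, δ * ‖u‖ ^ 2 ≤ inner ℝ (A u) u) : Function.Bijective A := by
  have hc : IsCoercive ((innerSL ℝ).comp A) := by
    refine ⟨δ, hδ, fun u => ?_⟩
    have := h u
    simp only [ContinuousLinearMap.comp_apply, innerSL_apply_apply]
    nlinarith
  have : (hc.continuousLinearEquivOfBilin : H → H) = A := by
    funext v
    refine ext_inner_right ℝ fun w => ?_
    rw [hc.continuousLinearEquivOfBilin_apply]
    simp
  rw [← this]
  exact hc.continuousLinearEquivOfBilin.bijective

/-- Data for a min-max argument: `T` is symmetric for the coercive form `⟨W u, v⟩`, and its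
quadratic form is at least `a` on the orthogonal complement of the vectors `e j`, in the
quantitative sense of `gap`. -/
structure SpectralGap {ι : Type*} [Fintype ι] (T W : H →L[ℝ] H) (e : ι → H) (a δ K : ℝ) :
    Prop where
  pos : 0 < δ
  coercive : ∀ u, δ * ‖u‖ ^ 2 ≤ inner ℝ (W u) u
  symm : ∀ u v, inner ℝ (W (T u)) v = inner ℝ u (W (T v))
  symm_weight : ∀ u v, inner ℝ (W u) v = inner ℝ u (W v)
  gap : ∀ u, a * inner ℝ (W u) u ≤ inner ℝ (W (T u)) u + K * ∑ j, inner ℝ (e j) u ^ 2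

namespace SpectralGap

variable {ι : Type*} [Fintype ι] {T W : H →L[ℝ] H} {e : ι → H} {a δ K : ℝ}

lemma weight_injective (h : SpectralGap T W e a δ K) : Function.Injective W := by
  rw [injective_iff_map_eq_zero]
  intro u hu
  have := h.coercive u
  rw [hu, inner_zero_left] at this
  have h2 : ‖u‖ ^ 2 ≤ 0 := nonpos_of_mul_nonpos_right this h.pos
  exact norm_eq_zero.1 (pow_eq_zero_iff two_ne_zero |>.1 (le_antisymm h2 (sq_nonneg _)))

lemma inner_weight_eq_zero (h : SpectralGap T W e a δ K) {s t : ℝ} (hst : s ≠ t) {u v : H}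
    (hu : T u = s • u) (hv : T v = t • v) : inner ℝ (W u) v = 0 := by
  have := h.symm u v
  rw [hu, hv, map_smul, map_smul, real_inner_smul_left, inner_smul_right,
    ← h.symm_weight] at this
  exact (mul_eq_mul_right_iff.1 this).resolve_left hst

/-- The vectors of a sum of eigenspaces with eigenvalues below `a` are determined by their
inner products with the `e j`. -/
lemma eq_zero_of_sum_eigenvectors (h : SpectralGap T W e a δ K) {F : Finset ℝ}
    (hF : ∀ t ∈ F, t < a) (u : F → H) (hu : ∀ t : F, T (u t) = (t : ℝ) • u t)
    (he : ∀ j, inner ℝ (e j) (∑ t, u t) = 0) : u = 0 := by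
  have horth : ∀ s t : F, s ≠ t → inner ℝ (W (u s)) (u t) = 0 := fun s t hst =>
    h.inner_weight_eq_zero (fun hh => hst (Subtype.ext hh)) (hu s) (hu t)
  -- Taken with $c=1$ for the weighted norm of the sum and with $c_t=t$ for its quadratic form under
  -- $T$.
  have hform : ∀ c : F → ℝ, inner ℝ (W (∑ s, c s • u s)) (∑ t, u t) =
      ∑ s, c s * inner ℝ (W (u s)) (u s) := by
    intro c
    rw [map_sum, sum_inner]
    refine Finset.sum_congr rfl fun s _ => ?_
    rw [map_smul, real_inner_smul_left, inner_sum]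
    congr 1
    exact Finset.sum_eq_single s (fun t _ hts => horth s t hts.symm) (by simp)
  have hg := h.gap (∑ t, u t)
  have h1 := hform 1
  simp only [Pi.one_apply, one_smul, one_mul] at h1
  have h2 : T (∑ t, u t) = ∑ t : F, (t : ℝ) • u t := by
    rw [map_sum]
    exact Finset.sum_congr rfl fun t _ => hu t
  rw [h2, hform (fun t => (t : ℝ)), h1] at hg
  simp only [he, ne_eq, OfNat.ofNat_ne_zero, not_false_eq_true, zero_pow, Finset.sum_const_zero,
    mul_zero, add_zero] at hg
  -- The gap inequality without its error term. All summands are nonnegative, so each one vanishes.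
  have h3 : ∑ s : F, (a - s) * inner ℝ (W (u s)) (u s) ≤ 0 := by
    simp only [sub_mul, Finset.sum_sub_distrib, ← Finset.mul_sum]
    linarith
  have h4 : ∀ s : F, 0 ≤ inner ℝ (W (u s)) (u s) := fun s =>
    (mul_nonneg h.pos.le (sq_nonneg _)).trans (h.coercive _)
  have h5 : ∀ s : F, 0 ≤ (a - s) * inner ℝ (W (u s)) (u s) := fun s =>
    mul_nonneg (sub_nonneg.2 (hF s s.2).le) (h4 s)
  funext s
  have h6 := (Finset.sum_eq_zero_iff_of_nonneg fun s _ => h5 s).1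
    (le_antisymm h3 (Finset.sum_nonneg fun s _ => h5 s)) s (Finset.mem_univ s)
  have h7 : inner ℝ (W (u s)) (u s) = 0 :=
    (mul_eq_zero.1 h6).resolve_left (sub_pos.2 (hF s s.2)).ne'
  have h8 := h.coercive (u s)
  rw [h7] at h8
  have h9 : ‖u s‖ ^ 2 ≤ 0 := nonpos_of_mul_nonpos_right h8 h.pos
  exact norm_eq_zero.1 (pow_eq_zero_iff two_ne_zero |>.1 (le_antisymm h9 (sq_nonneg _)))

/-- The map `Φ` pairs the sum of a family of eigenvectors with each `e j`. It is injective by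
`eq_zero_of_sum_eigenvectors`, so the dimensions add up to at most that of `ι → ℝ`. -/
lemma sum_eigenMultiplicity_le (h : SpectralGap T W e a δ K) {F : Finset ℝ}
    (hF : ∀ t ∈ F, t < a) : ∑ t ∈ F, eigenMultiplicity T t ≤ Fintype.card ι := by
  have hmem : ∀ (t : ℝ) (v : eigenspace T t), T v = t • (v : H) := fun t v =>
    Module.End.mem_eigenspace_iff.1 v.2
  let Φ : (∀ t : F, eigenspace T (t : ℝ)) →ₗ[ℝ] (ι → ℝ) :=
    LinearMap.pi fun j => (innerSL ℝ (e j) : H →ₗ[ℝ] ℝ) ∘ₗ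
      ∑ t : F, (eigenspace T (t : ℝ)).subtype ∘ₗ LinearMap.proj t
  have hΦ : Function.Injective Φ := by
    rw [injective_iff_map_eq_zero]
    intro u hu
    have := h.eq_zero_of_sum_eigenvectors hF (fun t => (u t : H)) (fun t => hmem t (u t))
      fun j => by simpa [Φ] using congrFun hu j
    funext t
    exact Subtype.ext (congrFun this t)
  have hfin : FiniteDimensional ℝ (∀ t : F, eigenspace T (t : ℝ)) :=
    FiniteDimensional.of_injective Φ hΦ
  have hfin' : ∀ t : F, FiniteDimensional ℝ (eigenspace T (t : ℝ)) := fun t => by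
    classical
    exact FiniteDimensional.of_injective
      (LinearMap.single ℝ (fun t : F => eigenspace T (t : ℝ)) t)
      (Pi.single_injective (M := fun t : F => eigenspace T (t : ℝ)) t)
  have hcard := LinearMap.finrank_le_finrank_of_injective hΦ
  rw [Module.finrank_pi_fintype, Module.finrank_fintype_fun_eq_card] at hcard
  rw [← Finset.sum_coe_sort]
  have : ∀ t : F, eigenMultiplicity T t = (Module.finrank ℝ (eigenspace T (t : ℝ)) : ℕ∞) := by
    intro t
    have := hfin' t
    rw [eigenMultiplicity, ← Module.finrank_eq_rank, map_natCast]
  simp only [this]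
  exact_mod_cast hcard

lemma eigenMultiplicity_le (h : SpectralGap T W e a δ K) {t : ℝ} (ht : t < a) :
    eigenMultiplicity T t ≤ Fintype.card ι := by
  simpa using h.sum_eigenMultiplicity_le (F := {t}) (by simpa using ht)

lemma injective_of_eigenMultiplicity_eq_zero {t : ℝ} (h0 : eigenMultiplicity T t = 0) :
    Function.Injective (T - t • ContinuousLinearMap.id ℝ H) := by
  rw [eigenMultiplicity, Cardinal.toENat_eq_zero, rank_zero_iff] at h0
  rw [injective_iff_map_eq_zero]
  intro u hu
  have hu' : u ∈ eigenspace T t := by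
    rw [eigenspace, Module.End.mem_eigenspace_iff]
    exact sub_eq_zero.1 hu
  exact congrArg Subtype.val (Subsingleton.elim (⟨u, hu'⟩ : eigenspace T t) 0)

/-- A Fredholm argument: $W(T-t)$ becomes coercive, hence bijective, after adding a finite-rank
operator. If $t$ is not an eigenvalue, it is injective and therefore surjective, so $T-t$ is
invertible. -/
lemma eigenMultiplicity_ne_zero [CompleteSpace H] (h : SpectralGap T W e a δ K) {t : ℝ}
    (ht : t < a) (hs : t ∈ spectrum ℝ T) : eigenMultiplicity T t ≠ 0 := by
  intro h0
  have hinj := injective_of_eigenMultiplicity_eq_zero h0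
  let F : H →L[ℝ] H := K • ∑ j, (innerSL ℝ (e j)).smulRight (e j)
  let D : H →L[ℝ] H := W.comp (T - t • ContinuousLinearMap.id ℝ H)
  have hF : ∀ u, F u = K • ∑ j, inner ℝ (e j) u • e j := fun u => by simp [F]
  have hA : Function.Bijective (D + F) := by
    -- The term $K\sum_j\langle e_j,u\rangle^2$ in `gap` is exactly the form of $F$, which leaves
    -- $(a-t)\langle Wu,u\rangle\ge(a-t)\delta\|u\|^2$.
    refine bijective_of_coercive (mul_pos (sub_pos.2 ht) h.pos) fun u => ?_
    have h1 := h.gap u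
    have h2 := mul_le_mul_of_nonneg_left (h.coercive u) (sub_pos.2 ht).le
    have h3 : inner ℝ ((D + F) u) u = inner ℝ (W (T u)) u - t * inner ℝ (W u) u +
        K * ∑ j, inner ℝ (e j) u ^ 2 := by
      rw [add_apply, inner_add_left, hF, real_inner_smul_left, sum_inner]
      simp [D, inner_sub_left, real_inner_smul_left, sq]
    rw [h3]
    linarith
  have hrange : (F : H →ₗ[ℝ] H).range ≤ Submodule.span ℝ (range e) := by
    rintro _ ⟨u, rfl⟩
    rw [ContinuousLinearMap.coe_coe, hF]
    exact Submodule.smul_mem _ _ (Submodule.sum_mem _ fun j _ =>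
      Submodule.smul_mem _ _ (Submodule.subset_span (mem_range_self j)))
  have hfd : FiniteDimensional ℝ (Submodule.span ℝ (range e)) :=
    FiniteDimensional.span_of_finite ℝ (finite_range e)
  have : FiniteDimensional ℝ (F : H →ₗ[ℝ] H).range := Submodule.finiteDimensional_of_le hrange
  have hD : (((D + F : H →L[ℝ] H) : H →ₗ[ℝ] H) - (F : H →ₗ[ℝ] H)) = (D : H →ₗ[ℝ] H) := by
    ext u; simp
  have hDs : Function.Surjective (D : H →ₗ[ℝ] H) := by
    rw [← hD]
    refine surjective_sub_of_finiteDimensional_range hA ?_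
    rw [hD]
    exact h.weight_injective.comp hinj
  have hsurj : Function.Surjective (T - t • ContinuousLinearMap.id ℝ H) := fun y => by
    obtain ⟨x, hx⟩ := hDs (W y)
    exact ⟨x, h.weight_injective hx⟩
  have hu : IsUnit (T - t • ContinuousLinearMap.id ℝ H) :=
    ContinuousLinearMap.isUnit_iff_bijective.2 ⟨hinj, hsurj⟩
  refine (spectrum.mem_iff.1 hs) ?_
  rw [← neg_sub, IsUnit.neg_iff, Algebra.algebraMap_eq_smul_one]
  exact hu

/-- Each spectral value below $a$ has multiplicity at least one, and the total multiplicity is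
bounded. -/
lemma finite_spectrum_inter_Iio [CompleteSpace H] (h : SpectralGap T W e a δ K) :
    (spectrum ℝ T ∩ Iio a).Finite := by
  by_contra hinf
  obtain ⟨F, hF, hcard⟩ := Set.Infinite.exists_subset_card_eq hinf (Fintype.card ι + 1)
  have h1 := h.sum_eigenMultiplicity_le (F := F) fun t ht => (hF ht).2
  have h2 : ∑ t ∈ F, (1 : ℕ∞) ≤ ∑ t ∈ F, eigenMultiplicity T t :=
    Finset.sum_le_sum fun t ht => Order.one_le_iff_pos.2 <| pos_iff_ne_zero.2 <|
      h.eigenMultiplicity_ne_zero (hF ht).2 (hF ht).1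
  have h3 := h2.trans h1
  rw [Finset.sum_const, hcard, nsmul_eq_mul, mul_one] at h3
  have h4 : Fintype.card ι + 1 ≤ Fintype.card ι := by exact_mod_cast h3
  omega

lemma mem_discreteSpectrum [CompleteSpace H] (h : SpectralGap T W e a δ K) {t : ℝ}
    (ht : t < a) (hs : t ∈ spectrum ℝ T) : t ∈ discreteSpectrum T := by
  refine ⟨hs, ?_, h.eigenMultiplicity_ne_zero ht hs,
    ((h.eigenMultiplicity_le ht).trans_lt (ENat.natCast_lt_top _)).ne⟩
  have hclosed : IsClosed ((spectrum ℝ T ∩ Iio a) \ {t}) :=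
    (h.finite_spectrum_inter_Iio.subset sdiff_subset).isClosed
  have hnhds : ((spectrum ℝ T ∩ Iio a) \ {t})ᶜ ∩ Iio a ∈ 𝓝 t :=
    inter_mem (hclosed.isOpen_compl.mem_nhds (by simp)) (Iio_mem_nhds ht)
  obtain ⟨ε, hε, hball⟩ := Metric.mem_nhds_iff.1 hnhds
  refine ⟨ε, hε, fun s hs' hst => ?_⟩
  obtain ⟨h1, h2⟩ := hball (show s ∈ ball t ε from hst)
  by_contra hne
  exact h1 ⟨⟨hs', h2⟩, hne⟩

/-- The min-max bound for the eigenvalue counting function. -/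
theorem eigenvalueCount_le [CompleteSpace H] (h : SpectralGap T W e a δ K) {R : ℝ} (hR : R < a) :
    eigenvalueCount T R ≤ Fintype.card ι := by
  have hl : (a : EReal) ≤ lambdaInfty T := by
    refine le_iInf₂ fun t ht => ?_
    by_contra hlt
    exact ht.2 (h.mem_discreteSpectrum (EReal.coe_lt_coe_iff.1 (not_le.1 hlt)) ht.1)
  rw [eigenvalueCount, if_neg (not_le.2 ((EReal.coe_lt_coe_iff.2 hR).trans_le hl))]
  exact iSup_le fun F => h.sum_eigenMultiplicity_le fun t ht => (F.2 ht).2.trans_lt hR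

end SpectralGap

end Abstract

end MMLaplacian

/-! ### Averages of functions over sets and over balls. -/

namespace MMLaplacian

lemma integrable_mul_Lp {Y : Type*} [MeasurableSpace Y] (μ : Measure Y) (u v : Lp ℝ 2 μ) :
    Integrable (fun x => u x * v x) μ :=
  (Lp.memLp u).integrable_mul (Lp.memLp v)

/-- If a function deviates little from the value `a` on a set, and its integral is small, then
`a` is small. -/
lemma measureReal_mul_sq_le {Y : Type*} [MeasurableSpace Y] {μ : Measure Y}
    [IsFiniteMeasure μ] {s : Set Y} {f : Y → ℝ} (hs : 0 < μ.real s) (a : ℝ)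
    (hf : IntegrableOn f s μ) (hf2 : IntegrableOn (fun y => (a - f y) ^ 2) s μ) :
    μ.real s * a ^ 2 ≤ 2 * ∫ y in s, (a - f y) ^ 2 ∂μ + 2 / μ.real s * (∫ y in s, f y ∂μ) ^ 2 := by
  set b := μ.real s
  set m := ∫ y in s, f y ∂μ
  have hc : ∀ c : ℝ, ∫ _ in s, c ∂μ = b * c := fun c => by simp [b, Measure.real]
  have hcI : ∀ c : ℝ, IntegrableOn (fun _ => c) s μ := fun c => integrable_const c
  -- Integrated form of $(a-f-t)^2\ge0$. The optimal $t$ is the mean $a-m/b$ of $a-f$, which gives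
  -- Jensen's inequality for the square.
  have h1 : ∀ t : ℝ, 2 * t * (b * a - m) - b * t ^ 2 ≤ ∫ y in s, (a - f y) ^ 2 ∂μ := by
    intro t
    have h2 : ∫ y in s, (2 * t * (a - f y) - t ^ 2) ∂μ = 2 * t * (b * a - m) - b * t ^ 2 := by
      have haf : IntegrableOn (fun y => a - f y) s μ := (hcI a).sub hf
      rw [integral_sub (haf.const_mul _) (hcI _), integral_const_mul, integral_sub (hcI a) hf, hc,
        hc]
    rw [← h2]
    refine integral_mono ((((hcI a).sub hf).const_mul _).sub (hcI _)) hf2 fun y => ?_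
    have := sq_nonneg (a - f y - t)
    dsimp only
    nlinarith
  have h3 := h1 (a - m / b)
  have h4 : 2 * (a - m / b) * (b * a - m) - b * (a - m / b) ^ 2 = b * (a - m / b) ^ 2 := by
    field_simp; ring
  rw [h4] at h3
  have h5 : 2 / b * m ^ 2 = 2 * (b * (m / b) ^ 2) := by field_simp
  have h6 : a ^ 2 ≤ 2 * (a - m / b) ^ 2 + 2 * (m / b) ^ 2 := by
    nlinarith [sq_nonneg (a - m / b - m / b)]
  rw [h5]
  nlinarith [mul_le_mul_of_nonneg_left h6 hs.le]

section Kernel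

variable {X : Type*} [MetricSpace X] [MeasurableSpace X] [BorelSpace X]

/-- Turns ball averages into integrals of a kernel on $X\times X$ with symmetric domain, ready for
Fubini. -/
lemma integral_indicator_dist_lt (μ : Measure X) (ρ : ℝ) (f g : X → ℝ) (x : X) :
    ∫ y, {p : X × X | dist p.2 p.1 < ρ}.indicator (fun p => g p.1 * f p.2) (x, y) ∂μ =
      g x * ∫ y in ball x ρ, f y ∂μ := by
  rw [← integral_const_mul, ← integral_indicator measurableSet_ball]
  rfl

variable [SecondCountableTopology X]

lemma measurableSet_dist_lt (ρ : ℝ) : MeasurableSet {p : X × X | dist p.2 p.1 < ρ} :=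
  (isOpen_lt (continuous_snd.dist continuous_fst) continuous_const).measurableSet

lemma integrable_indicator_dist_lt {μ : Measure X} [SFinite μ] (ρ : ℝ) {f g : X → ℝ} (hf : Integrable f μ) (hg : Integrable g μ) :
    Integrable ({p : X × X | dist p.2 p.1 < ρ}.indicator fun p => g p.1 * f p.2) (μ.prod μ) :=
  (hg.mul_prod hf).indicator (measurableSet_dist_lt ρ)

variable (μ : Measure X) [IsFiniteMeasure μ] (ρ : ℝ)

lemma measurable_measureReal_ball : Measurable fun x => μ.real (ball x ρ) :=
  (measurable_measure_prodMk_left (measurableSet_dist_lt ρ)).ennreal_toReal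

variable {μ}

lemma integrable_mul_setIntegral_ball {f g : X → ℝ} (hf : Integrable f μ)
    (hg : Integrable g μ) : Integrable (fun x => g x * ∫ y in ball x ρ, f y ∂μ) μ := by
  simpa only [integral_indicator_dist_lt] using
    (integrable_indicator_dist_lt ρ hf hg).integral_prod_left

/-- Averaging over balls of a fixed radius is symmetric. -/
lemma integral_mul_setIntegral_ball_comm {f g : X → ℝ} (hf : Integrable f μ)
    (hg : Integrable g μ) : ∫ x, g x * ∫ y in ball x ρ, f y ∂μ ∂μ =
      ∫ x, f x * ∫ y in ball x ρ, g y ∂μ ∂μ := by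
  simp_rw [← integral_indicator_dist_lt]
  rw [integral_integral_swap (f := fun x y =>
    {p : X × X | dist p.2 p.1 < ρ}.indicator (fun p => g p.1 * f p.2) (x, y))
    (integrable_indicator_dist_lt ρ hf hg)]
  refine integral_congr_ae (Eventually.of_forall fun x => integral_congr_ae
    (Eventually.of_forall fun y => ?_))
  simp only [indicator_apply, mem_ofPred_eq, dist_comm x y, mul_comm]

lemma integrable_setIntegral_ball {f : X → ℝ} (hf : Integrable f μ) :
    Integrable (fun x => ∫ y in ball x ρ, f y ∂μ) μ := by
  simpa using integrable_mul_setIntegral_ball ρ hf (integrable_const 1)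

lemma integral_setIntegral_ball {f : X → ℝ} (hf : Integrable f μ) :
    ∫ x, ∫ y in ball x ρ, f y ∂μ ∂μ = ∫ x, μ.real (ball x ρ) * f x ∂μ := by
  simpa [mul_comm] using integral_mul_setIntegral_ball_comm ρ hf (integrable_const 1)

lemma integrable_measureReal_ball_mul {f : X → ℝ} (hf : Integrable f μ) :
    Integrable (fun x => μ.real (ball x ρ) * f x) μ :=
  hf.bdd_mul (c := μ.real univ) (measurable_measureReal_ball μ ρ).aestronglyMeasurable
    (Eventually.of_forall fun x => by
      rw [Real.norm_of_nonneg measureReal_nonneg]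
      exact measureReal_mono (subset_univ _))

end Kernel

/-! ### The weighted Dirichlet form and its lower bound. -/

section Weight

variable {X : Type*} [MetricSpace X] [MeasurableSpace X] [BorelSpace X] [CompactSpace X]
  (μ : Measure X) [IsFiniteMeasure μ] (ρ : ℝ)

lemma memLp_top_measureReal_ball : MemLp (fun x => μ.real (ball x ρ)) ∞ μ :=
  memLp_top_of_bound (measurable_measureReal_ball μ ρ).aestronglyMeasurable (μ.real univ)
    (Eventually.of_forall fun x => by
      rw [Real.norm_of_nonneg measureReal_nonneg]
      exact measureReal_mono (subset_univ _))

/-- Multiplication by the volume of the balls of radius `ρ`, as an operator on `L²`. -/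
noncomputable def ballWeight : Lp ℝ 2 μ →L[ℝ] Lp ℝ 2 μ :=
  (ContinuousLinearMap.mul ℝ ℝ).holderL μ ∞ 2 2 ((memLp_top_measureReal_ball μ ρ).toLp)

lemma ballWeight_coeFn (u : Lp ℝ 2 μ) :
    ballWeight μ ρ u =ᵐ[μ] fun x => μ.real (ball x ρ) * u x := by
  filter_upwards [(ContinuousLinearMap.mul ℝ ℝ).coeFn_holder (r := 2)
    ((memLp_top_measureReal_ball μ ρ).toLp) u, (memLp_top_measureReal_ball μ ρ).coeFn_toLp]
    with x h1 h2
  refine h1.trans ?_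
  rw [h2]
  rfl

lemma inner_ballWeight (u v : Lp ℝ 2 μ) :
    inner ℝ (ballWeight μ ρ u) v = ∫ x, μ.real (ball x ρ) * (u x * v x) ∂μ := by
  rw [L2.inner_def]
  refine integral_congr_ae ?_
  filter_upwards [ballWeight_coeFn μ ρ u] with x hx
  simp [hx]
  ring

/-- The weight cancels the normalisation by $\mu(B_\rho(x))$; what remains is a multiplication term
and a symmetric kernel. -/
lemma inner_ballWeight_rhoLaplacian (u v : Lp ℝ 2 μ) :
    inner ℝ (ballWeight μ ρ (rhoLaplacian μ ρ u)) v =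
      (ρ ^ 2)⁻¹ * (∫ x, μ.real (ball x ρ) * (u x * v x) ∂μ -
        ∫ x, v x * ∫ y in ball x ρ, u y ∂μ ∂μ) := by
  rw [inner_ballWeight, ← integral_sub (integrable_measureReal_ball_mul ρ
    (integrable_mul_Lp μ u v)) (integrable_mul_setIntegral_ball ρ (integrable_Lp μ u)
    (integrable_Lp μ v)), ← integral_const_mul]
  refine integral_congr_ae ?_
  filter_upwards [rhoLaplacian_coeFn μ ρ u] with x hx
  rw [hx, rhoLapFun, integral_sub (integrable_const _) (integrable_Lp μ u).integrableOn,
    mul_inv]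
  rcases eq_or_ne (μ.real (ball x ρ)) 0 with h0 | h0
  · have : μ.restrict (ball x ρ) = 0 :=
      Measure.restrict_eq_zero.2 ((measureReal_eq_zero_iff).1 h0)
    simp [h0, this]
  · simp only [integral_const, smul_eq_mul, measureReal_restrict_apply_univ]
    field_simp

/-- The Dirichlet form of the `ρ`-Laplacian. -/
lemma integral_setIntegral_ball_sq_sub {ρ : ℝ} (hρ : ρ ≠ 0) (u : Lp ℝ 2 μ) :
    Integrable (fun x => ∫ y in ball x ρ, (u x - u y) ^ 2 ∂μ) μ ∧
    ∫ x, ∫ y in ball x ρ, (u x - u y) ^ 2 ∂μ ∂μ =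
      2 * ρ ^ 2 * inner ℝ (ballWeight μ ρ (rhoLaplacian μ ρ u)) u := by
  have hu := integrable_Lp μ u
  have hu2 := integrable_mul_Lp μ u u
  have hexp : ∀ x, ∫ y in ball x ρ, (u x - u y) ^ 2 ∂μ = μ.real (ball x ρ) * (u x * u x) -
      2 * (u x * ∫ y in ball x ρ, u y ∂μ) + ∫ y in ball x ρ, u y * u y ∂μ := by
    intro x
    have h1 : ∀ y, (u x - u y) ^ 2 = u x * u x - 2 * u x * u y + u y * u y := fun y => by ring
    simp_rw [h1]
    have h2 : Integrable (fun y => u x * u x - 2 * u x * u y) μ :=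
      (integrable_const _).sub (hu.const_mul _)
    rw [integral_add h2.integrableOn hu2.integrableOn,
      integral_sub (integrable_const _) (hu.const_mul _).integrableOn,
      integral_const_mul (2 * u x) (fun y => u y)]
    simp only [integral_const, smul_eq_mul, measureReal_restrict_apply_univ, mul_assoc]
  simp_rw [hexp]
  have i1 := integrable_measureReal_ball_mul ρ hu2
  have i2 := (integrable_mul_setIntegral_ball ρ hu hu).const_mul 2
  have i3 := integrable_setIntegral_ball ρ hu2
  have i12 : Integrable (fun x => μ.real (ball x ρ) * (u x * u x) -
      2 * (u x * ∫ y in ball x ρ, u y ∂μ)) μ := i1.sub i2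
  refine ⟨i12.add i3, ?_⟩
  rw [integral_add i12 i3, integral_sub i1 i2, integral_setIntegral_ball ρ hu2,
    integral_const_mul, inner_ballWeight_rhoLaplacian]
  field_simp
  ring

lemma exists_pos_le_measureReal_ball {ρ : ℝ} (hρ : 0 < ρ) :
    ∃ δ > 0, ∀ᵐ x ∂μ, δ ≤ μ.real (ball x ρ) := by
  obtain ⟨C, hC0, hC⟩ := exists_inv_le μ ρ
  -- `C + 1` makes the witness positive even for `C = 0`. On the support the ball has positive
  -- measure, so the bound on the inverse is genuine.
  refine ⟨(ρ ^ 2 * (C + 1))⁻¹, by positivity, ?_⟩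
  filter_upwards [hC, Measure.support_mem_ae (μ := μ)] with x hx hsupp
  have hpos : 0 < μ.real (ball x ρ) := ENNReal.toReal_pos
    ((Measure.mem_support_iff_forall x).1 hsupp _ (ball_mem_nhds x hρ)).ne' (measure_ne_top _ _)
  rw [mul_inv] at hx ⊢
  rw [inv_mul_le_iff₀ (by positivity)] at hx
  rw [← mul_inv, inv_le_comm₀ (by positivity) hpos]
  nlinarith [sq_nonneg ρ]

lemma exists_coercive_ballWeight {ρ : ℝ} (hρ : 0 < ρ) :
    ∃ δ > 0, ∀ u : Lp ℝ 2 μ, δ * ‖u‖ ^ 2 ≤ inner ℝ (ballWeight μ ρ u) u := by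
  obtain ⟨δ, hδ, h⟩ := exists_pos_le_measureReal_ball μ hρ
  refine ⟨δ, hδ, fun u => ?_⟩
  rw [inner_ballWeight, ← real_inner_self_eq_norm_sq, L2.inner_def, ← integral_const_mul]
  refine integral_mono_ae ((integrable_mul_Lp μ u u).const_mul δ)
    (integrable_measureReal_ball_mul ρ (integrable_mul_Lp μ u u)) ?_
  filter_upwards [h] with x hx
  simpa [← sq] using mul_le_mul_of_nonneg_right hx (mul_self_nonneg (u x))

/-- A finite `ρ/24`-net of the support, with volume control of the balls around its points, gives
a lower bound for the Dirichlet form in terms of the averages around the points of the net. -/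
lemma spectralGap_of_net {ρ Λ : ℝ} (hρ : 0 < ρ) (hΛ : 0 < Λ) {S : Set X} [Fintype S]
    (hS : S ⊆ μ.support) (hnet : ∀ y ∈ μ.support, ∃ x ∈ S, dist y x < ρ / 24)
    (hvol : ∀ x ∈ S, μ.real (ball x (5 / 4 * ρ)) ≤ Λ * μ.real (ball x (5 / 6 * ρ))) :
    ∃ δ K, SpectralGap (rhoLaplacian μ ρ) (ballWeight μ ρ)
      (fun x : S => indicatorConstLp 2 (measurableSet_ball (x := (x : X)) (ε := 5 / 6 * ρ))
        (measure_ne_top μ _) (1 : ℝ)) ((4 * Λ)⁻¹ * ρ⁻¹ ^ 2) δ K := by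
  obtain ⟨δ, hδ, hcoer⟩ := exists_coercive_ballWeight μ hρ
  set b : S → ℝ := fun x => μ.real (ball (x : X) (5 / 6 * ρ))
  have hbpos : ∀ x, 0 < b x := fun x => ENNReal.toReal_pos
    ((Measure.mem_support_iff_forall _).1 (hS x.2) _
      (ball_mem_nhds _ (by positivity))).ne' (measure_ne_top _ _)
  -- The error constant may be crude: it sums the contributions of all net points, and its size
  -- never enters the count.
  refine ⟨δ, (4 * Λ)⁻¹ * ρ⁻¹ ^ 2 * (μ.real univ * ∑ x, Λ * (2 / b x)), hδ, hcoer, ?_, ?_, ?_⟩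
  · intro u v
    rw [inner_ballWeight_rhoLaplacian, real_inner_comm, inner_ballWeight_rhoLaplacian,
      integral_mul_setIntegral_ball_comm ρ (integrable_Lp μ u) (integrable_Lp μ v)]
    simp only [mul_comm]
  · intro u v
    rw [inner_ballWeight, real_inner_comm, inner_ballWeight]
    simp only [mul_comm]
  intro u
  obtain ⟨hGint, hG⟩ := integral_setIntegral_ball_sq_sub μ hρ.ne' u
  simp_rw [L2.inner_indicatorConstLp_one]
  have hu := integrable_Lp μ u
  have hsq : ∀ a : ℝ, Integrable (fun y => (a - u y) ^ 2) μ := fun a =>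
    ((memLp_const a).sub (Lp.memLp u)).integrable_sq
  set V := ∑ x : S, (∫ y in ball (x : X) (5 / 6 * ρ), u y ∂μ) ^ 2
  have hpt : ∀ᵐ y ∂μ, μ.real (ball y ρ) * (u y * u y) ≤
      2 * Λ * ∫ z in ball y ρ, (u y - u z) ^ 2 ∂μ + (∑ x, Λ * (2 / b x)) * V := by
    filter_upwards [Measure.support_mem_ae (μ := μ)] with y hy
    obtain ⟨x, hx, hxy⟩ := hnet y hy
    -- The inclusions behind `h1` and `h3` hold since $1+\frac1{24}\le\frac54$ and
    -- $\frac56+\frac1{24}\le1$.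
    have h1 : μ.real (ball y ρ) ≤ Λ * b ⟨x, hx⟩ :=
      (measureReal_mono (ball_subset_ball' (by linarith))).trans (hvol x hx)
    have h2 := measureReal_mul_sq_le (hbpos ⟨x, hx⟩) (u y) hu.integrableOn (hsq (u y)).integrableOn
    have h3 : ∫ z in ball x (5 / 6 * ρ), (u y - u z) ^ 2 ∂μ ≤
        ∫ z in ball y ρ, (u y - u z) ^ 2 ∂μ :=
      setIntegral_mono_set (hsq (u y)).integrableOn (Eventually.of_forall fun z => sq_nonneg _)
        (ball_subset_ball' (by rw [dist_comm]; linarith)).eventuallyLE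
    have h4 : (∫ z in ball x (5 / 6 * ρ), u z ∂μ) ^ 2 ≤ V :=
      Finset.single_le_sum (f := fun x : S => (∫ y in ball (x : X) (5 / 6 * ρ), u y ∂μ) ^ 2)
        (fun x _ => sq_nonneg _) (Finset.mem_univ ⟨x, hx⟩)
    have h5 : Λ * (2 / b ⟨x, hx⟩) ≤ ∑ x, Λ * (2 / b x) :=
      Finset.single_le_sum (f := fun x => Λ * (2 / b x))
        (fun x _ => by have := hbpos x; positivity) (Finset.mem_univ (⟨x, hx⟩ : S))
    have h6 : 0 ≤ Λ * (2 / b ⟨x, hx⟩) := by have := hbpos ⟨x, hx⟩; positivity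
    calc μ.real (ball y ρ) * (u y * u y) ≤ Λ * b ⟨x, hx⟩ * (u y * u y) := by
          gcongr; exact mul_self_nonneg _
      _ = Λ * (b ⟨x, hx⟩ * u y ^ 2) := by ring
      _ ≤ Λ * (2 * (∫ z in ball y ρ, (u y - u z) ^ 2 ∂μ) +
            2 / b ⟨x, hx⟩ * (∫ z in ball x (5 / 6 * ρ), u z ∂μ) ^ 2) := by
          gcongr
          exact h2.trans (by gcongr)
      _ = 2 * Λ * ∫ z in ball y ρ, (u y - u z) ^ 2 ∂μ +
            Λ * (2 / b ⟨x, hx⟩) * (∫ z in ball x (5 / 6 * ρ), u z ∂μ) ^ 2 := by ring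
      _ ≤ _ := by
          gcongr
  have hint := integral_mono_ae (integrable_measureReal_ball_mul ρ (integrable_mul_Lp μ u u))
    ((hGint.const_mul (2 * Λ)).add (integrable_const ((∑ x, Λ * (2 / b x)) * V))) hpt
  rw [← inner_ballWeight] at hint
  simp only [Pi.add_apply] at hint
  rw [integral_add (hGint.const_mul (2 * Λ)) (integrable_const _), integral_const_mul, hG,
    integral_const, smul_eq_mul] at hint
  -- The factor $4\Lambda\rho^2$ is $2\Lambda$ from the pointwise bound times $2\rho^2$ from the
  -- Dirichlet form.
  refine (mul_le_mul_of_nonneg_left hint (by positivity)).trans_eq ?_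
  field_simp
  ring

end Weight

/-! ### Separated nets and the conclusion. -/

/-- A set that does not contain arbitrarily large separated subsets has a finite net. -/
lemma exists_finite_net {X : Type*} [MetricSpace X] {r : ℝ} (hr : 0 < r)
    (hfin : packNumber X r ≠ ⊤) (A : Set X) : ∃ S ⊆ A, S.Finite ∧
      S.encard ≤ packNumber X r ∧ ∀ y ∈ A, ∃ x ∈ S, dist y x < r := by
  obtain ⟨S, hS⟩ := zorn_subset {S : Set X | S ⊆ A ∧ S.Pairwise fun x y => r ≤ dist x y} (by
    intro c hc hchain
    refine ⟨⋃₀ c, ⟨sUnion_subset fun s hs => (hc hs).1, ?_⟩, fun s hs => subset_sUnion_of_mem hs⟩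
    exact (pairwise_sUnion hchain.directedOn).2 fun s hs => (hc hs).2)
  have hle : S.encard ≤ packNumber X r :=
    le_iSup (fun S : {S : Set X // S.Pairwise fun x y => r ≤ dist x y} => S.1.encard)
      ⟨S, hS.prop.2⟩
  refine ⟨S, hS.prop.1, encard_lt_top_iff.1 (hle.trans_lt hfin.lt_top), hle, fun y hy => ?_⟩
  by_contra! hfar
  -- A point of `A` far from all of `S` could be added, against maximality.
  have hins : insert y S ∈ {S : Set X | S ⊆ A ∧ S.Pairwise fun x y => r ≤ dist x y} :=
    ⟨insert_subset hy hS.prop.1, hS.prop.2.insert fun x hx _ =>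
      ⟨hfar x hx, by rw [dist_comm]; exact hfar x hx⟩⟩
  have hyS : y ∈ S := hS.le_of_ge hins (subset_insert y S) (mem_insert y S)
  have := hfar y hyS
  rw [dist_self] at this
  linarith

end MMLaplacian

theorem theorem7p1 (Λ : ℝ) (hΛ : 1 ≤ Λ) :
    ∃ c : ℝ, 0 < c ∧
      ∀ (X : Type*) [MetricSpace X] [CompactSpace X] [MeasurableSpace X] [BorelSpace X]
        (μ : Measure X) [IsFiniteMeasure μ] (ρ : ℝ), 0 < ρ →
        MMLaplacian.BIV μ Λ (5 / 6 * ρ) (5 / 12 * ρ) →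
        (∀ x ∈ μ.support, μ.real (ball x (5 * ρ / 3)) ≤ Λ * μ.real (ball x (5 * ρ / 6))) →
        MMLaplacian.eigenvalueCount (MMLaplacian.rhoLaplacian μ ρ) (c * ρ⁻¹ ^ 2) ≤
          MMLaplacian.packNumber X (ρ / 24) := by
  have hΛ0 : 0 < Λ := zero_lt_one.trans_le hΛ
  -- Half the gap constant $(4\Lambda)^{-1}$: `eigenvalueCount_le` needs `R` strictly below the gap.
  refine ⟨(8 * Λ)⁻¹, by positivity, fun X _ _ _ _ μ _ ρ hρ hBIV _ => ?_⟩
  by_cases hfin : MMLaplacian.packNumber X (ρ / 24) = ⊤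
  · rw [hfin]; exact le_top
  obtain ⟨S, hSsupp, hSfin, hScard, hnet⟩ :=
    MMLaplacian.exists_finite_net (by positivity) hfin μ.support
  have := hSfin.fintype
  have hvol : ∀ x ∈ S, μ.real (ball x (5 / 4 * ρ)) ≤ Λ * μ.real (ball x (5 / 6 * ρ)) := by
    intro x hx
    -- On the diagonal, BIV compares concentric balls of radii $\frac54\rho$ and $\frac56\rho$.
    have h := hBIV x (hSsupp hx) x (hSsupp hx) (by rw [dist_self]; positivity)
    rw [inter_self, inv_mul_le_iff₀ hΛ0] at h
    rwa [show 5 / 6 * ρ + 5 / 12 * ρ = 5 / 4 * ρ by ring] at h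
  obtain ⟨δ, K, hgap⟩ := MMLaplacian.spectralGap_of_net μ hρ hΛ0 hSsupp hnet hvol
  have hR : (8 * Λ)⁻¹ * ρ⁻¹ ^ 2 < (4 * Λ)⁻¹ * ρ⁻¹ ^ 2 := by gcongr; norm_num
  refine (hgap.eigenvalueCount_le hR).trans (le_of_eq_of_le ?_ hScard)
  rw [Set.encard_eq_coe_toFinset_card, Set.toFinset_card]
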